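/- Setting. Let $L,M>0$. Let $D\subseteq\mathbb R^d$ be an open convex set (the points of interest, for instance $D=\mathbb R^d$), and let $f:\mathbb R^d\to\mathbb R$ be twice differentiable on $D$, with $\nabla f$ $L$-Lipschitz on $D$, $\nabla^2 f$ $M$-Lipschitz on $D$ in the spectral norm, and $f\ge\bar f$ on $D$. Given tolerances $\epsilon_g,\epsilon_H>0$, a starting point $x_0$ and a bound $\alpha$ on the negative-curvature stepsizes, consider the following algorithm. At iteration $k=0,1,2,\dots$ it has an approximate gradient $g_k$, an approximate Hessian $H_k$ (symmetric), and a unit vector $\hat p_k$, with $\hat\lambda_k:=\hat p_k^TH_k\hat p_k$. * If $\|g_k\|>\epsilon_g$, set $x_{k+1}=x_k-\frac1L g_k$. * Otherwise, if $\hat\lambda_k<-\epsilon_H$, choose $\alpha_k\in[\epsilon_H,\min(\alpha,|\hat\lambda_k|)]$, draw $\sigma_k=\pm1$ with probability $\frac12$ each, independently of everything known before the draw (the history up to and including $g_k,H_k,\hat p_k$), and set $x_{k+1}=x_k+\frac{2\alpha_k}{M}\sigma_k\hat p_k$. * Otherwise return $x_k$. The quantities $g_k,H_k,\hat p_k$ may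 depend on the history, but not on $\sigma_k$ or later signs. Almost surely, at every iteration $k$ that is reached, $x_k\in D$ and $$\|g_k-\nabla f(x_k)\|\le\tfrac13\max\{\epsilon_g,\|g_k\|\},$$ and, when $\|g_k\|\le\epsilon_g$ (so that a Hessian is requested), $$\|H_k-\nabla^2f(x_k)\|\le\tfrac29\epsilon_H,\qquad |\hat\lambda_k-\lambda_{\min}(H_k)|\le\tfrac19\epsilon_H .$$ For $\delta\in(0,1)$ and an integer $\eta\ge2$, put $\Delta=f(x_0)-\bar f$, $C_\epsilon=\min\left(\frac{\epsilon_g^2}{6L},\frac{2\epsilon_H^3}{9M^2}\right)$, $B=1+\frac{18\alpha L}{M\epsilon_g}$, $C=2304\frac{M^2\alpha^2\epsilon_g^2}{\epsilon_H^6}$, $$K=\max\left\{C\log\tfrac1\delta,\;4\eta C\left(\tfrac{\Delta}{C_\epsilon}\right)^{1/\eta},\;4\eta^2C^{1+\frac1{\eta-1}}B^{\frac1{\eta-1}}\right\},\qquad n=\frac{2\Delta}{C_\epsilon}+BK .$$ Statement. Let $\epsilon_g=\epsilon>0$, $\epsilon_H=\sqrt{\epsilon M}$ and $\alpha_k=|\hat\lambda_k|$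 at every negative-curvature step. 1. One can take $\alpha=2L$: almost surely, $\alpha_k=|\hat\lambda_k|\in[\epsilon_H,\min(2L,|\hat\lambda_k|)]$ at every negative-curvature step. With $\alpha=2L$ in the definitions above, for all $\delta\in(0,1)$ and all integers $\eta\ge2$ the algorithm terminates within $n$ iterations (it returns at an iteration with index $k<n$) with probability at least $1-\delta$. 2. As $\epsilon\downarrow0$ (with $\alpha = 2L$ and $L,M$ fixed), $B=O(1/\epsilon)$ and $C=O(1/\epsilon)$. 3. For $\eta=11$ and fixed $L,M,\delta$ and fixed $\Delta\ge0$, $K=\tilde O(\epsilon^{-1.2})$ and $n=\tilde O(\epsilon^{-2.2})$ as $\epsilon\downarrow0$, where $F=\tilde O(G)$ means $F=O(G\log^jG)$ for some constant $j\in\mathbb N$. More precisely, for every integer $\eta\ge2$ there is a constant $c>0$ depending only on $L,M,\Delta,\eta$ such that, for all $\epsilon\in(0,1]$ and $\delta\in(0,1)$, $$K\le c\,\left(1+\log\tfrac1\delta\right)\epsilon^{-1-\frac2{\eta-1}},\qquad n\le c\,\left(1+\log\tfrac1\delta\right)\epsilon^{-2-\frac2{\eta-1}} .$$ 4. Larger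 values of $\eta$ bring the bound closer to $\tilde O(\epsilon^{-2})$: for every $\kappa>0$ there is $\eta_0$ such that $n=\tilde O(\epsilon^{-2-\kappa})$ for all $\eta\ge\eta_0$ and all fixed $\delta\in(0,1)$. This is at the expense of a larger constant factor: there are constants $c_\eta$ (depending on $L,M,\Delta,\eta$ only) with $c_\eta\to\infty$ as $\eta\to\infty$ such that, for every $\eta\ge2$ and $\delta\in(0,1)$, $\lim_{\epsilon\downarrow0}n\,\epsilon^{2+\frac2{\eta-1}}=c_\eta$. -/

import Mathlib

open Filter Topology MeasureTheory ProbabilityTheory Asymptotics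

noncomputable section

namespace InexactNC

/-- `ℝ^d` with the Euclidean norm. -/
abbrev E (d : ℕ) : Type := EuclideanSpace ℝ (Fin d)

/-- The Hessian of `f` at `x`, as a linear operator on `ℝ^d` (its norm is the spectral norm). -/
def hessian {d : ℕ} (f : E d → ℝ) (x : E d) : E d →L[ℝ] E d :=
  fderiv ℝ (gradient f) x

/-- The smallest eigenvalue of an operator on `ℝ^d` (used for self-adjoint operators only). -/
def minEigenvalue {d : ℕ} (A : E d →L[ℝ] E d) : ℝ :=
  sInf {μ : ℝ | Module.End.HasEigenvalue (A : E d →ₗ[ℝ] E d) μ}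

/-- On the region `D` of points of interest (an open convex set, for instance all of `ℝ^d`),
`f` is twice differentiable, its gradient is `L`-Lipschitz, its Hessian is `M`-Lipschitz, and
`f` is bounded below by `fbar`. -/
structure BasicAssumption {d : ℕ} (f : E d → ℝ) (D : Set (E d)) (L M fbar : ℝ) : Prop where
  isOpen : IsOpen D
  convex : Convex ℝ D
  differentiableAt : ∀ x ∈ D, DifferentiableAt ℝ f x
  differentiableAt_gradient : ∀ x ∈ D, DifferentiableAt ℝ (gradient f) x
  gradient_lipschitz : ∀ x ∈ D, ∀ y ∈ D, ‖gradient f x - gradient f y‖ ≤ L * ‖x - y‖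
  hessian_lipschitz : ∀ x ∈ D, ∀ y ∈ D, ‖hessian f x - hessian f y‖ ≤ M * ‖x - y‖
  bounded_below : ∀ x ∈ D, fbar ≤ f x

/-- What the algorithm receives at iteration `k`: the approximate gradient `g k`, the
approximate Hessian `H k`, and the approximate eigenvector `p k` of `H k`. All of them are
random: they may depend on the past of the run. -/
structure Oracle (d : ℕ) (Ω : Type*) where
  g : ℕ → Ω → E d
  H : ℕ → Ω → E d →L[ℝ] E d
  p : ℕ → Ω → E d

/-- The approximate smallest eigenvalue `pᵀ H p`. -/
def Oracle.lam {d : ℕ} {Ω : Type*} (O : Oracle d Ω) (k : ℕ) (ω : Ω) : ℝ :=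
  inner ℝ (O.p k ω) (O.H k ω (O.p k ω))

section Algorithm

variable {d : ℕ} {Ω : Type*}

/-- Iteration `k` (if it is reached) is a negative curvature step. -/
def NegCurvStep (εg εH : ℝ) (O : Oracle d Ω) (k : ℕ) (ω : Ω) : Prop :=
  ‖O.g k ω‖ ≤ εg ∧ O.lam k ω < -εH

/-- Iteration `k` (if it is reached) returns the current point. -/
def Returns (εg εH : ℝ) (O : Oracle d Ω) (k : ℕ) (ω : Ω) : Prop :=
  ‖O.g k ω‖ ≤ εg ∧ -εH ≤ O.lam k ω

/-- The algorithm has not returned before iteration `k`. -/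
def Reached (εg εH : ℝ) (O : Oracle d Ω) (k : ℕ) (ω : Ω) : Prop :=
  ∀ j < k, ¬ Returns εg εH O j ω

open Classical in
/-- The iterates: a gradient step if `‖g k‖ > εg`, otherwise a negative curvature step with
stepsize `a k` and random sign `σ k` if `lam k < -εH`, and otherwise the algorithm stops. -/
def iterate (L M εg εH : ℝ) (x₀ : E d) (O : Oracle d Ω) (a σ : ℕ → Ω → ℝ) : ℕ → Ω → E d
  | 0, _ => x₀
  | k + 1, ω =>
    if εg < ‖O.g k ω‖ then
      iterate L M εg εH x₀ O a σ k ω - (1 / L) • O.g k ω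
    else if O.lam k ω < -εH then
      iterate L M εg εH x₀ O a σ k ω + (2 * a k ω / M * σ k ω) • O.p k ω
    else
      iterate L M εg εH x₀ O a σ k ω

/-- The algorithm returns at one of the iterations `0, 1, 2, …` with index less than `n`. -/
def TerminatesWithin (εg εH : ℝ) (O : Oracle d Ω) (n : ℝ) (ω : Ω) : Prop :=
  ∃ k : ℕ, (k : ℝ) < n ∧ Reached εg εH O k ω ∧ Returns εg εH O k ω

/-- The signs: `σ k` is `1` or `-1` with probability `1/2` each, independently of everything
(`ℱ k`) that is known at iteration `k` before it is drawn. -/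
structure RandomSigns [mΩ : MeasurableSpace Ω] (μ : Measure Ω) (ℱ : Filtration ℕ mΩ)
    (σ : ℕ → Ω → ℝ) : Prop where
  measurable : ∀ k, Measurable[ℱ (k + 1)] (σ k)
  prob_one : ∀ k, μ {ω | σ k ω = 1} = 1 / 2
  prob_neg_one : ∀ k, μ {ω | σ k ω = -1} = 1 / 2
  indep : ∀ k, Indep (MeasurableSpace.comap (σ k) inferInstance) (ℱ k) μ

/-- What is received at iteration `k` is known before the sign `σ k` is drawn. -/
structure Oracle.Nonanticipating [mΩ : MeasurableSpace Ω] (O : Oracle d Ω)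
    (ℱ : Filtration ℕ mΩ) : Prop where
  g : ∀ k, StronglyMeasurable[ℱ k] (O.g k)
  H : ∀ k, StronglyMeasurable[ℱ k] (O.H k)
  p : ∀ k, StronglyMeasurable[ℱ k] (O.p k)

/-- The inexactness assumptions along a run with iterates `x`, at the iterations that the
algorithm reaches; those on the Hessian and its eigenvector where a Hessian is requested. -/
def InexactnessAssumption (f : E d → ℝ) (D : Set (E d)) (εg εH : ℝ) (O : Oracle d Ω)
    (x : ℕ → Ω → E d) (ω : Ω) : Prop :=
  ∀ k, Reached εg εH O k ω →
    x k ω ∈ D ∧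
    ‖O.g k ω - gradient f (x k ω)‖ ≤ 1 / 3 * max εg ‖O.g k ω‖ ∧
    (‖O.g k ω‖ ≤ εg →
      IsSelfAdjoint (O.H k ω) ∧
      ‖O.H k ω - hessian f (x k ω)‖ ≤ 2 / 9 * εH ∧
      ‖O.p k ω‖ = 1 ∧
      |O.lam k ω - minEigenvalue (O.H k ω)| ≤ 1 / 9 * εH)

end Algorithm

/-- `C_ε = min (εg² / (6L)) (2 εH³ / (9M²))`. -/
def decrease (L M εg εH : ℝ) : ℝ := min (εg ^ 2 / (6 * L)) (2 * εH ^ 3 / (9 * M ^ 2))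

def constB (L M α εg : ℝ) : ℝ := 1 + 18 * α * L / (M * εg)

def constC (M α εg εH : ℝ) : ℝ := 2304 * (M ^ 2 * α ^ 2 * εg ^ 2 / εH ^ 6)

/-- `K`, with `Δ = f x₀ - fbar`. -/
def constK (L M α εg εH Δ δ : ℝ) (η : ℕ) : ℝ :=
  max (constC M α εg εH * Real.log (1 / δ))
    (max (4 * η * constC M α εg εH * (Δ / decrease L M εg εH) ^ (1 / (η : ℝ)))
      (4 * (η : ℝ) ^ 2 * constC M α εg εH ^ (1 + 1 / ((η : ℝ) - 1)) *
        constB L M α εg ^ (1 / ((η : ℝ) - 1))))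

/-- The iteration bound `n = 2 Δ / C_ε + B K`. -/
def constN (L M α εg εH Δ δ : ℝ) (η : ℕ) : ℝ :=
  2 * (Δ / decrease L M εg εH) + constB L M α εg * constK L M α εg εH Δ δ η

/-! The same quantities for `εg = ε`, `εH = √(εM)`, `α = 2L`. -/

def longB (L M ε : ℝ) : ℝ := constB L M (2 * L) ε

def longC (L M ε : ℝ) : ℝ := constC M (2 * L) ε (Real.sqrt (ε * M))

def longK (L M Δ δ : ℝ) (η : ℕ) (ε : ℝ) : ℝ :=
  constK L M (2 * L) ε (Real.sqrt (ε * M)) Δ δ η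

def longN (L M Δ δ : ℝ) (η : ℕ) (ε : ℝ) : ℝ :=
  constN L M (2 * L) ε (Real.sqrt (ε * M)) Δ δ η

/-- `f = Õ(g)`: `f = O(g log^k g)` for some constant `k`. -/
def IsBigOTilde (l : Filter ℝ) (f g : ℝ → ℝ) : Prop :=
  ∃ k : ℕ, f =O[l] fun t => g t * Real.log (g t) ^ k

end InexactNC

end

namespace InexactNC

/-! ### Taylor bounds on the region of interest -/

/-! Probability of termination. Both kinds of step lower `f` by at least `m = decrease …`, except
that a negative curvature step adds a first-order term `σ k * Y k`. The coefficient `Y k` is known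
before the sign is drawn. It is at most `c = 16Lε/(3M)` in absolute value, because the gradient has
norm at most `4ε/3` and the stepsize is at most `2L`. If the algorithm has not returned before
iteration `N = ⌈n⌉₊`, telescoping and `fbar ≤ f` give `∑ σ k * Y k ≥ N m - Δ`. This is at least `N m
/ 2`, since `n` contains `2Δ/m`. The Azuma–Hoeffding inequality bounds the probability of this event
by `exp (-N m² / (8c²))`. Finally `N ≥ B C log (1/δ)`, and `8c² ≤ B C m²`
(`sq_le_longB_mul_longC_mul_sq`), so the bound is at most `δ`. Of the maximum defining `K` only its
first entry is needed, so the argument is the same for every `η`.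

Size of the constants. For this choice of tolerances `B = 1 + β/ε` and `C = γ/ε` exactly, while `m`
is bounded below by a multiple of `ε²` on `(0, 1]` and equals `ε²/(6L)` for small `ε`. The entries
of `K` are then of order `ε^(-1)`, `ε^(-1-2/η)` and `ε^(-1-2/(η-1))`, so the last one governs the
rate. Multiplication by `B` costs one more power of `ε`. The limiting constant of `n` grows like
`η²`. -/

/-- Comparison of a function with a bound on its derivative, on `[0, 1]`. -/
theorem le_of_hasDerivAt_le {φ φ' ψ ψ' : ℝ → ℝ}
    (hφ : ∀ t ∈ Set.Icc (0 : ℝ) 1, HasDerivAt φ (φ' t) t) (hψ : ∀ t, HasDerivAt ψ (ψ' t) t)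
    (h0 : φ 0 ≤ ψ 0) (h : ∀ t ∈ Set.Icc (0 : ℝ) 1, φ' t ≤ ψ' t) :
    ∀ t ∈ Set.Icc (0 : ℝ) 1, φ t ≤ ψ t := by
  intro t ht
  exact image_le_of_deriv_right_le_deriv_boundary
    (fun t ht => (hφ t ht).continuousAt.continuousWithinAt)
    (fun t ht => (hφ t ⟨ht.1, ht.2.le⟩).hasDerivWithinAt) h0
    (fun t _ => (hψ t).continuousAt.continuousWithinAt)
    (fun t _ => (hψ t).hasDerivWithinAt)
    (fun t ht => h t ⟨ht.1, ht.2.le⟩) ht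

section Taylor

variable {d : ℕ} {f : E d → ℝ} {D : Set (E d)} {L M fbar : ℝ}

theorem BasicAssumption.segment_mem (h : BasicAssumption f D L M fbar) {x s : E d} (hx : x ∈ D)
    (hy : x + s ∈ D) {t : ℝ} (ht : t ∈ Set.Icc (0 : ℝ) 1) : x + t • s ∈ D := by
  have := h.convex.add_smul_sub_mem hx hy ht
  simpa using this

theorem hasDerivAt_line (x s : E d) (t : ℝ) : HasDerivAt (fun t : ℝ => x + t • s) s t := by
  simpa using ((hasDerivAt_id t).smul_const s).const_add x

theorem BasicAssumption.hasDerivAt_line (h : BasicAssumption f D L M fbar) {x s : E d}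
    {t : ℝ} (ht : x + t • s ∈ D) :
    HasDerivAt (fun t : ℝ => f (x + t • s)) (inner ℝ (gradient f (x + t • s)) s) t := by
  have h1 := (h.differentiableAt _ ht).hasGradientAt.hasFDerivAt
  exact h1.comp_hasDerivAt t (InexactNC.hasDerivAt_line x s t)

theorem BasicAssumption.hasDerivAt_gradient_line (h : BasicAssumption f D L M fbar) {x s : E d}
    {t : ℝ} (ht : x + t • s ∈ D) :
    HasDerivAt (fun t : ℝ => (inner ℝ (gradient f (x + t • s)) s : ℝ))
      (inner ℝ (hessian f (x + t • s) s) s) t := by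
  have h1 := (h.differentiableAt_gradient _ ht).hasFDerivAt
  have h2 := h1.comp_hasDerivAt t (InexactNC.hasDerivAt_line x s t)
  simpa [hessian] using h2.inner ℝ (hasDerivAt_const t s)

/-- The Lipschitz bound on the gradient is integrated along the segment from `x` to `x + s`. Only
the endpoints need to be known to lie in `D`, by convexity. -/
theorem BasicAssumption.le_quadratic (h : BasicAssumption f D L M fbar) {x s : E d} (hx : x ∈ D)
    (hy : x + s ∈ D) : f (x + s) ≤ f x + inner ℝ (gradient f x) s + L / 2 * ‖s‖ ^ 2 := by
  have := le_of_hasDerivAt_le (φ := fun t : ℝ => f (x + t • s))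
    (ψ := fun t : ℝ => f x + t * inner ℝ (gradient f x) s + L / 2 * t ^ 2 * ‖s‖ ^ 2)
    (ψ' := fun t : ℝ => inner ℝ (gradient f x) s + L * t * ‖s‖ ^ 2)
    (fun t ht => h.hasDerivAt_line (h.segment_mem hx hy ht))
    (fun t => by
      have h1 := ((hasDerivAt_id t).mul_const (inner ℝ (gradient f x) s)).const_add (f x)
      have h2 := (((hasDerivAt_pow 2 t).const_mul (L / 2)).mul_const (‖s‖ ^ 2))
      refine (h1.add h2).congr_deriv ?_
      push_cast; ring) (by simp)
    (fun t ht => by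
      have h1 := h.gradient_lipschitz _ (h.segment_mem hx hy ht) _ hx
      have h2 := real_inner_le_norm (gradient f (x + t • s) - gradient f x) s
      rw [inner_sub_left] at h2
      have h3 : ‖x + t • s - x‖ = t * ‖s‖ := by
        simp [norm_smul, abs_of_nonneg ht.1]
      rw [h3] at h1
      nlinarith [mul_le_mul_of_nonneg_right h1 (norm_nonneg s)]) 1 (by simp)
  simpa using this

/-- Two integrations along the segment: the Hessian bound controls the directional derivative
(`key`), which in turn controls `f`. -/
theorem BasicAssumption.le_cubic (h : BasicAssumption f D L M fbar) {x s : E d} (hx : x ∈ D)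
    (hy : x + s ∈ D) :
    f (x + s) ≤ f x + inner ℝ (gradient f x) s + 1 / 2 * inner ℝ (hessian f x s) s +
      M / 6 * ‖s‖ ^ 3 := by
  have key := le_of_hasDerivAt_le (φ := fun t : ℝ => inner ℝ (gradient f (x + t • s)) s)
    (ψ := fun t : ℝ => inner ℝ (gradient f x) s + t * inner ℝ (hessian f x s) s +
      M / 2 * t ^ 2 * ‖s‖ ^ 3)
    (ψ' := fun t : ℝ => inner ℝ (hessian f x s) s + M * t * ‖s‖ ^ 3)
    (fun t ht => h.hasDerivAt_gradient_line (h.segment_mem hx hy ht))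
    (fun t => by
      have h1 := ((hasDerivAt_id t).mul_const (inner ℝ (hessian f x s) s)).const_add
        (inner ℝ (gradient f x) s)
      have h2 := (((hasDerivAt_pow 2 t).const_mul (M / 2)).mul_const (‖s‖ ^ 3))
      refine (h1.add h2).congr_deriv ?_
      push_cast; ring) (by simp)
    (fun t ht => by
      have h1 := h.hessian_lipschitz _ (h.segment_mem hx hy ht) _ hx
      have h2 := real_inner_le_norm ((hessian f (x + t • s) - hessian f x) s) s
      have h4 := (hessian f (x + t • s) - hessian f x).le_opNorm s
      rw [sub_apply, inner_sub_left] at h2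
      rw [sub_apply] at h4
      have h3 : ‖x + t • s - x‖ = t * ‖s‖ := by
        simp [norm_smul, abs_of_nonneg ht.1]
      rw [h3] at h1
      have h5 := h4.trans (mul_le_mul_of_nonneg_right h1 (norm_nonneg s))
      nlinarith [mul_le_mul_of_nonneg_right h5 (norm_nonneg s)])
  have := le_of_hasDerivAt_le (φ := fun t : ℝ => f (x + t • s))
    (ψ := fun t : ℝ => f x + t * inner ℝ (gradient f x) s +
      1 / 2 * t ^ 2 * inner ℝ (hessian f x s) s + M / 6 * t ^ 3 * ‖s‖ ^ 3)
    (ψ' := fun t : ℝ => inner ℝ (gradient f x) s + t * inner ℝ (hessian f x s) s +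
      M / 2 * t ^ 2 * ‖s‖ ^ 3)
    (fun t ht => h.hasDerivAt_line (h.segment_mem hx hy ht))
    (fun t => by
      have h1 := ((hasDerivAt_id t).mul_const (inner ℝ (gradient f x) s)).const_add (f x)
      have h2 := (((hasDerivAt_pow 2 t).const_mul (1 / 2)).mul_const
        (inner ℝ (hessian f x s) s))
      have h3 := (((hasDerivAt_pow 3 t).const_mul (M / 6)).mul_const (‖s‖ ^ 3))
      refine ((h1.add h2).add h3).congr_deriv ?_
      push_cast; ring) (by simp) key 1 (by simp)
  simpa using this

/-- The derivative of an `L`-Lipschitz map has norm at most `L`; openness of `D` makes the Lipschitz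
bound available on a neighbourhood. -/
theorem BasicAssumption.norm_hessian_le (h : BasicAssumption f D L M fbar) (hL : 0 ≤ L) {x : E d}
    (hx : x ∈ D) : ‖hessian f x‖ ≤ L := by
  refine (h.differentiableAt_gradient x hx).hasFDerivAt.le_of_lip' hL ?_
  filter_upwards [h.isOpen.mem_nhds hx] with y hy
  exact h.gradient_lipschitz y hy x hx

/-! ### One iteration -/

/-- A relative error of `1/3` leaves `⟪∇f, g⟫ ≥ (2/3)‖g‖²`. The quadratic term costs half of
`‖g‖²/L`, and `2/3 - 1/2 = 1/6`. -/
theorem BasicAssumption.gradient_step (h : BasicAssumption f D L M fbar) (hL : 0 < L)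
    {x g : E d} {εg : ℝ} (hεg : 0 ≤ εg) (hx : x ∈ D) (hy : x - (1 / L) • g ∈ D) (hg : εg < ‖g‖)
    (hgf : ‖g - gradient f x‖ ≤ 1 / 3 * max εg ‖g‖) :
    f (x - (1 / L) • g) ≤ f x - εg ^ 2 / (6 * L) := by
  rw [max_eq_right hg.le] at hgf
  have h1 := h.le_quadratic hx (s := -((1 / L) • g)) (by rwa [← sub_eq_add_neg])
  rw [← sub_eq_add_neg, norm_neg, norm_smul, inner_neg_right, inner_smul_right] at h1
  have h2 := real_inner_le_norm (g - gradient f x) g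
  rw [inner_sub_left, real_inner_self_eq_norm_sq] at h2
  have h3 : ‖g‖ ^ 2 * (2 / 3) ≤ inner ℝ (gradient f x) g := by
    nlinarith [mul_le_mul_of_nonneg_right hgf (norm_nonneg g)]
  have h4 : εg ^ 2 ≤ ‖g‖ ^ 2 := by gcongr
  have h5 : 1 / L * (‖g‖ ^ 2 * (2 / 3)) ≤ 1 / L * inner ℝ (gradient f x) g := by gcongr
  have h6 : L / 2 * (‖(1 / L : ℝ)‖ * ‖g‖) ^ 2 = 1 / L * (‖g‖ ^ 2 / 2) := by
    rw [Real.norm_of_nonneg (by positivity)]; field_simp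
  have h7 : εg ^ 2 / (6 * L) = 1 / L * (εg ^ 2 / 6) := by field_simp
  have h8 : 1 / L * (εg ^ 2 / 6) ≤ 1 / L * (‖g‖ ^ 2 / 6) := by gcongr
  rw [h6] at h1
  rw [h7]
  linarith

/-- With `a = |pᵀHp| > εH`, the true curvature along `p` is at most `-7a/9`. A step of length `2a/M`
gains `14/9` from curvature and loses `12/9` to the cubic remainder, in units of `a³/M²`; the net
gain is `2/9`. The first-order term has no known sign and is kept as a multiple of `σ`. -/
theorem BasicAssumption.negCurv_step (h : BasicAssumption f D L M fbar) (hM : 0 < M)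
    {x p : E d} {H : E d →L[ℝ] E d} {εH σ : ℝ} (hεH : 0 ≤ εH) (hσ : σ = 1 ∨ σ = -1) (hx : x ∈ D)
    (hp : ‖p‖ = 1) (hlam : inner ℝ p (H p) < -εH) (hH : ‖H - hessian f x‖ ≤ 2 / 9 * εH)
    (hy : x + (2 * |inner ℝ p (H p)| / M * σ) • p ∈ D) :
    f (x + (2 * |inner ℝ p (H p)| / M * σ) • p) ≤ f x - 2 * εH ^ 3 / (9 * M ^ 2) +
      σ * (2 * |inner ℝ p (H p)| / M * inner ℝ (gradient f x) p) := by
  have h1 := h.le_cubic hx hy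
  set a := |(inner ℝ p (H p) : ℝ)| with ha
  have hneg : (inner ℝ p (H p) : ℝ) = -a := by rw [ha, abs_of_neg (by linarith)]; ring
  have haH : εH ≤ a := by linarith
  have hσ2 : σ ^ 2 = 1 := by rcases hσ with rfl | rfl <;> norm_num
  have hσa : |σ| = 1 := by rcases hσ with rfl | rfl <;> norm_num
  have ha0 : 0 ≤ a := abs_nonneg _
  have hn : ‖(2 * a / M * σ) • p‖ = 2 * a / M := by
    rw [norm_smul, hp, Real.norm_eq_abs, abs_mul, hσa, abs_of_nonneg (by positivity)]; ring
  have hcurv : (inner ℝ (hessian f x p) p : ℝ) ≤ -a + 2 / 9 * a := by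
    have h2 := real_inner_le_norm p ((hessian f x - H) p)
    have h3 := (hessian f x - H).le_opNorm p
    rw [norm_sub_rev] at hH
    rw [sub_apply, inner_sub_right, hneg, real_inner_comm] at h2
    rw [sub_apply] at h3
    rw [hp] at h2 h3
    linarith
  have hq : (1 / 2 * inner ℝ (hessian f x ((2 * a / M * σ) • p)) ((2 * a / M * σ) • p) : ℝ) =
      2 * a ^ 2 / M ^ 2 * inner ℝ (hessian f x p) p := by
    rw [map_smul, real_inner_smul_left, real_inner_smul_right]
    linear_combination (2 * a ^ 2 / M ^ 2 * inner ℝ (hessian f x p) p : ℝ) * hσ2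
  rw [hq, hn, real_inner_smul_right] at h1
  have h4 : 2 * a ^ 2 / M ^ 2 * inner ℝ (hessian f x p) p ≤
      2 * a ^ 2 / M ^ 2 * (-a + 2 / 9 * a) := by gcongr
  have h5 : 2 * a ^ 2 / M ^ 2 * (-a + 2 / 9 * a) + M / 6 * (2 * a / M) ^ 3 =
      -(2 * a ^ 3 / (9 * M ^ 2)) := by field_simp; ring
  have h6 : 2 * εH ^ 3 / (9 * M ^ 2) ≤ 2 * a ^ 3 / (9 * M ^ 2) := by gcongr
  linarith

/-- The stepsize `2L` is admissible. -/
theorem BasicAssumption.abs_lam_le (h : BasicAssumption f D L M fbar) (hL : 0 < L)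
    {x p : E d} {H : E d →L[ℝ] E d} {εH : ℝ} (hx : x ∈ D)
    (hp : ‖p‖ = 1) (hlam : inner ℝ p (H p) < -εH) (hH : ‖H - hessian f x‖ ≤ 2 / 9 * εH) :
    |inner ℝ p (H p)| ≤ 2 * L := by
  have h1 := abs_real_inner_le_norm p (H p)
  have h2 := H.le_opNorm p
  have h3 : ‖H‖ ≤ ‖H - hessian f x‖ + ‖hessian f x‖ := by
    simpa using norm_add_le (H - hessian f x) (hessian f x)
  have h4 := h.norm_hessian_le hL.le hx
  rw [hp] at h1 h2
  -- Since `εH < |pᵀHp|`, the bounds give `|pᵀHp| ≤ L + (2/9)|pᵀHp|`, that is, at most `9L/7`.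
  have h5 := neg_le_abs (inner ℝ p (H p) : ℝ)
  linarith

theorem abs_inner_gradient_le {x g p : E d} {εg : ℝ} (hp : ‖p‖ = 1) (hg : ‖g‖ ≤ εg)
    (hgf : ‖g - gradient f x‖ ≤ 1 / 3 * max εg ‖g‖) :
    |inner ℝ (gradient f x) p| ≤ 4 / 3 * εg := by
  rw [max_eq_left hg] at hgf
  have h1 := abs_real_inner_le_norm (gradient f x) p
  rw [hp, mul_one] at h1
  have h2 : ‖gradient f x‖ ≤ ‖g‖ + ‖g - gradient f x‖ := by
    simpa using norm_sub_le g (g - gradient f x)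
  linarith

end Taylor

/-! ### Exponential moments of sums with random signs -/

section Signs

variable {Ω : Type*} [mΩ : MeasurableSpace Ω] {μ : Measure Ω}
  {ℱ : Filtration ℕ mΩ} {σ : ℕ → Ω → ℝ}

theorem RandomSigns.measurable' (h : RandomSigns μ ℱ σ) (k : ℕ) : Measurable (σ k) :=
  (h.measurable k).mono (ℱ.le _) le_rfl

variable {Y : ℕ → Ω → ℝ} {c : ℝ}

theorem RandomSigns.stronglyMeasurable_sum (h : RandomSigns μ ℱ σ)
    (hY : ∀ k, StronglyMeasurable[ℱ k] (Y k)) (N : ℕ) :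
    StronglyMeasurable[ℱ N] fun ω => ∑ k ∈ Finset.range N, σ k ω * Y k ω := by
  refine Finset.stronglyMeasurable_fun_sum _ fun k hk => ?_
  have hk' : k + 1 ≤ N := Finset.mem_range.1 hk
  exact ((h.measurable k).stronglyMeasurable.mono (ℱ.mono hk')).mul
    ((hY k).mono (ℱ.mono (Nat.le_of_succ_le hk')))

variable [IsProbabilityMeasure μ]

theorem RandomSigns.ae_eq (h : RandomSigns μ ℱ σ) : ∀ᵐ ω ∂μ, ∀ k, σ k ω = 1 ∨ σ k ω = -1 := by
  rw [ae_all_iff]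
  intro k
  have m1 : MeasurableSet {ω | σ k ω = 1} := h.measurable' k (measurableSet_singleton 1)
  have m2 : MeasurableSet {ω | σ k ω = -1} := h.measurable' k (measurableSet_singleton (-1))
  have hd : Disjoint {ω | σ k ω = 1} {ω | σ k ω = -1} := by
    rw [Set.disjoint_left]
    intro ω h1 h2
    simp only [Set.mem_ofPred_eq] at h1 h2
    linarith
  have hu : μ ({ω | σ k ω = 1} ∪ {ω | σ k ω = -1}) = 1 := by
    rw [measure_union hd m2, h.prob_one, h.prob_neg_one, ENNReal.add_halves]
  exact (prob_compl_eq_zero_iff (m1.union m2)).2 hu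

theorem RandomSigns.integral_eq_zero (h : RandomSigns μ ℱ σ) (k : ℕ) : ∫ ω, σ k ω ∂μ = 0 := by
  have m1 : MeasurableSet {ω | σ k ω = 1} := h.measurable' k (measurableSet_singleton 1)
  have m2 : MeasurableSet {ω | σ k ω = -1} := h.measurable' k (measurableSet_singleton (-1))
  have he : σ k =ᵐ[μ] fun ω => Set.indicator {ω | σ k ω = 1} (1 : Ω → ℝ) ω -
      Set.indicator {ω | σ k ω = -1} (1 : Ω → ℝ) ω := by
    filter_upwards [h.ae_eq] with ω hω
    rcases hω k with h1 | h1 <;> norm_num [Set.indicator, h1]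
  rw [integral_congr_ae he, integral_sub ((integrable_const 1).indicator m1)
    ((integrable_const 1).indicator m2), integral_indicator_one m1, integral_indicator_one m2,
    measureReal_def, measureReal_def, h.prob_one, h.prob_neg_one, sub_self]

/-- The martingale difference property, from independence and the zero mean of the sign. The product
formula needs no integrability of `Z`. -/
theorem RandomSigns.integral_mul_eq_zero (h : RandomSigns μ ℱ σ) {k : ℕ} {Z : Ω → ℝ}
    (hZ : StronglyMeasurable[ℱ k] Z) : ∫ ω, σ k ω * Z ω ∂μ = 0 := by
  have hi : IndepFun (σ k) Z μ := by
    rw [IndepFun_iff_Indep]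
    exact indep_of_indep_of_le_right (h.indep k) hZ.measurable.comap_le
  rw [hi.integral_fun_mul_eq_mul_integral (h.measurable' k).aestronglyMeasurable
    (hZ.mono (ℱ.le k)).aestronglyMeasurable, h.integral_eq_zero, zero_mul]

theorem RandomSigns.abs_sum_le (h : RandomSigns μ ℱ σ) (hc : ∀ k ω, |Y k ω| ≤ c) (N : ℕ) :
    ∀ᵐ ω ∂μ, |∑ k ∈ Finset.range N, σ k ω * Y k ω| ≤ N * c := by
  filter_upwards [h.ae_eq] with ω hω
  refine (Finset.abs_sum_le_sum_abs _ _).trans ?_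
  calc ∑ k ∈ Finset.range N, |σ k ω * Y k ω| ≤ ∑ k ∈ Finset.range N, c := by
        refine Finset.sum_le_sum fun k _ => ?_
        rw [abs_mul]
        rcases hω k with h1 | h1 <;> simpa [h1] using hc k ω
    _ = N * c := by simp

theorem RandomSigns.integrable_exp_sum (h : RandomSigns μ ℱ σ)
    (hY : ∀ k, StronglyMeasurable[ℱ k] (Y k)) (hc : ∀ k ω, |Y k ω| ≤ c) (s : ℝ) (N : ℕ) :
    Integrable (fun ω => Real.exp (s * ∑ k ∈ Finset.range N, σ k ω * Y k ω)) μ := by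
  refine Integrable.of_bound (C := Real.exp (|s| * (N * c)))
    (Real.continuous_exp.comp_stronglyMeasurable (((h.stronglyMeasurable_sum hY N).mono
      (ℱ.le N)).const_mul s)).aestronglyMeasurable ?_
  filter_upwards [h.abs_sum_le hc N] with ω hω
  rw [Real.norm_of_nonneg (Real.exp_pos _).le, Real.exp_le_exp]
  refine (le_abs_self _).trans ?_
  rw [abs_mul]
  gcongr

/-- For `σ = ±1`, `exp (s σ Y) = cosh (s Y) + σ sinh (s Y)`. The `sinh` part integrates to zero
against the past, and `cosh u ≤ exp (u²/2)` bounds the rest; induction on `N` then needs no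
conditional expectations. -/
theorem RandomSigns.integral_exp_sum_le (h : RandomSigns μ ℱ σ)
    (hY : ∀ k, StronglyMeasurable[ℱ k] (Y k)) (hc : ∀ k ω, |Y k ω| ≤ c) (s : ℝ) (N : ℕ) :
    ∫ ω, Real.exp (s * ∑ k ∈ Finset.range N, σ k ω * Y k ω) ∂μ ≤
      Real.exp (N * (s ^ 2 * c ^ 2 / 2)) := by
  induction N with
  | zero => simp
  | succ N ih =>
    set e : Ω → ℝ := fun ω => Real.exp (s * ∑ k ∈ Finset.range N, σ k ω * Y k ω) with he
    have hei : Integrable e μ := h.integrable_exp_sum hY hc s N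
    have hem : StronglyMeasurable[ℱ N] e :=
      Real.continuous_exp.comp_stronglyMeasurable ((h.stronglyMeasurable_sum hY N).const_mul s)
    have hch : StronglyMeasurable[ℱ N] fun ω => Real.cosh (s * Y N ω) :=
      Real.continuous_cosh.comp_stronglyMeasurable ((hY N).const_mul s)
    have hsh : StronglyMeasurable[ℱ N] fun ω => Real.sinh (s * Y N ω) :=
      Real.continuous_sinh.comp_stronglyMeasurable ((hY N).const_mul s)
    have hcosh : ∀ ω, Real.cosh (s * Y N ω) ≤ Real.exp (s ^ 2 * c ^ 2 / 2) := fun ω => by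
      refine (Real.cosh_le_exp_half_sq _).trans (Real.exp_le_exp.2 ?_)
      have : Y N ω ^ 2 ≤ c ^ 2 := by
        rw [← sq_abs (Y N ω)]
        exact pow_le_pow_left₀ (abs_nonneg _) (hc N ω) 2
      rw [mul_pow]
      gcongr
    have hci : Integrable (fun ω => e ω * Real.cosh (s * Y N ω)) μ := by
      refine hei.mul_bdd (c := Real.exp (s ^ 2 * c ^ 2 / 2))
        (hch.mono (ℱ.le N)).aestronglyMeasurable (Eventually.of_forall fun ω => ?_)
      rw [Real.norm_of_nonneg (Real.cosh_pos _).le]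
      exact hcosh ω
    have hstep : (fun ω => Real.exp (s * ∑ k ∈ Finset.range (N + 1), σ k ω * Y k ω)) =ᵐ[μ]
        fun ω => e ω * Real.cosh (s * Y N ω) + σ N ω * (e ω * Real.sinh (s * Y N ω)) := by
      filter_upwards [h.ae_eq] with ω hω
      rw [Finset.sum_range_succ, mul_add, Real.exp_add]
      rcases hω N with h1 | h1
      · rw [h1, one_mul, one_mul, ← mul_add, Real.cosh_add_sinh]
      · rw [h1, neg_one_mul, neg_one_mul, ← sub_eq_add_neg, ← mul_sub, Real.cosh_sub_sinh,
          mul_neg]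
    have hsi : Integrable (fun ω => σ N ω * (e ω * Real.sinh (s * Y N ω))) μ := by
      have := ((h.integrable_exp_sum hY hc s (N + 1)).congr hstep).sub hci
      simpa [Pi.sub_def] using this
    rw [integral_congr_ae hstep, integral_add hci hsi,
      h.integral_mul_eq_zero (Z := fun ω => e ω * Real.sinh (s * Y N ω)) (hem.mul hsh), add_zero]
    calc ∫ ω, e ω * Real.cosh (s * Y N ω) ∂μ
        ≤ ∫ ω, e ω * Real.exp (s ^ 2 * c ^ 2 / 2) ∂μ :=
          integral_mono hci (hei.mul_const _) fun ω =>
            mul_le_mul_of_nonneg_left (hcosh ω) (Real.exp_pos _).le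
      _ ≤ Real.exp (N * (s ^ 2 * c ^ 2 / 2)) * Real.exp (s ^ 2 * c ^ 2 / 2) := by
          rw [integral_mul_const]
          gcongr
      _ = Real.exp ((N + 1 : ℕ) * (s ^ 2 * c ^ 2 / 2)) := by
          rw [← Real.exp_add]; push_cast; ring_nf

/-- The Azuma–Hoeffding inequality for sums with random signs. -/
theorem RandomSigns.measureReal_sum_ge_le (h : RandomSigns μ ℱ σ)
    (hY : ∀ k, StronglyMeasurable[ℱ k] (Y k)) (hc0 : 0 < c) (hc : ∀ k ω, |Y k ω| ≤ c) {N : ℕ}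
    {t : ℝ} (ht : 0 ≤ t) (hN : 0 < N) :
    μ.real {ω | N * t ≤ ∑ k ∈ Finset.range N, σ k ω * Y k ω} ≤
      Real.exp (-(N * t ^ 2 / (2 * c ^ 2))) := by
  -- `s = t / c²` minimises the Chernoff exponent `-s N t + N s² c² / 2`.
  refine (measure_ge_le_exp_mul_mgf (t := t / c ^ 2) (N * t) (by positivity)
    (h.integrable_exp_sum hY hc _ N)).trans ?_
  refine (mul_le_mul_of_nonneg_left (h.integral_exp_sum_le hY hc _ N) (Real.exp_pos _).le).trans ?_
  rw [← Real.exp_add]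
  refine le_of_eq (congrArg _ ?_)
  field_simp
  ring

end Signs

/-! ### The constants for `εg = ε`, `εH = √(εM)`, `α = 2L` -/

theorem longB_eq {L M ε : ℝ} : longB L M ε = 1 + 36 * L ^ 2 / M / ε := by
  rw [longB, constB, div_div]; ring

theorem longC_eq {L M ε : ℝ} (hM : 0 < M) (hε : 0 < ε) :
    longC L M ε = 9216 * L ^ 2 / M / ε := by
  have h6 : Real.sqrt (ε * M) ^ 6 = (ε * M) ^ 3 := by
    rw [show 6 = 2 * 3 from rfl, pow_mul, Real.sq_sqrt (by positivity)]
  rw [longC, constC, h6]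
  field_simp
  ring

theorem decrease_pos {L M εg εH : ℝ} (hL : 0 < L) (hM : 0 < M) (hg : 0 < εg) (hH : 0 < εH) :
    0 < decrease L M εg εH :=
  lt_min (by positivity) (by positivity)

theorem constC_mul_log_le_constK (L M α εg εH Δ δ : ℝ) (η : ℕ) :
    constC M α εg εH * Real.log (1 / δ) ≤ constK L M α εg εH Δ δ η :=
  le_max_left _ _

theorem log_one_div_pos {δ : ℝ} (h0 : 0 < δ) (h1 : δ < 1) : 0 < Real.log (1 / δ) :=
  Real.log_pos (by rw [lt_div_iff₀ h0]; linarith)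

/-- The comparison of constants behind the probability of termination. -/
theorem sq_le_longB_mul_longC_mul_sq {L M ε : ℝ} (hL : 0 < L) (hM : 0 < M) (hε : 0 < ε) :
    8 * (16 * L * ε / (3 * M)) ^ 2 ≤
      longB L M ε * longC L M ε * decrease L M ε (Real.sqrt (ε * M)) ^ 2 := by
  have hβ : 0 < 36 * L ^ 2 / M / ε := by positivity
  have hC : 0 < longC L M ε := by rw [longC_eq hM hε]; positivity
  -- The lower bound used for `B` depends on which term attains the minimum: `36L²/(Mε)` in the
  -- gradient case, `1` in the curvature case.
  have key : ∀ b x : ℝ, b ≤ longB L M ε →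
      8 * (16 * L * ε / (3 * M)) ^ 2 ≤ b * longC L M ε * x ^ 2 →
      8 * (16 * L * ε / (3 * M)) ^ 2 ≤ longB L M ε * longC L M ε * x ^ 2 := fun b x hb h =>
    h.trans (by gcongr)
  rcases min_choice (ε ^ 2 / (6 * L)) (2 * Real.sqrt (ε * M) ^ 3 / (9 * M ^ 2)) with h | h
  · rw [decrease, h]
    refine key (36 * L ^ 2 / M / ε) _ (by rw [longB_eq]; linarith) ?_
    rw [longC_eq hM hε]
    have : 36 * L ^ 2 / M / ε * (9216 * L ^ 2 / M / ε) * (ε ^ 2 / (6 * L)) ^ 2 =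
        9216 * (L ^ 2 * ε ^ 2 / M ^ 2) := by field_simp; norm_num
    rw [this, show 8 * (16 * L * ε / (3 * M)) ^ 2 = 2048 / 9 * (L ^ 2 * ε ^ 2 / M ^ 2) by
      field_simp; norm_num]
    gcongr
    norm_num
  · rw [decrease, h]
    refine key 1 _ (by rw [longB_eq]; linarith) ?_
    have h6 : (2 * Real.sqrt (ε * M) ^ 3 / (9 * M ^ 2)) ^ 2 =
        4 * (ε * M) ^ 3 / (81 * M ^ 4) := by
      rw [div_pow, mul_pow, ← pow_mul, show 3 * 2 = 2 * 3 from rfl, pow_mul,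
        Real.sq_sqrt (by positivity)]
      ring
    rw [longC_eq hM hε, h6]
    have : 1 * (9216 * L ^ 2 / M / ε) * (4 * (ε * M) ^ 3 / (81 * M ^ 4)) =
        4096 / 9 * (L ^ 2 * ε ^ 2 / M ^ 2) := by field_simp; norm_num
    rw [this, show 8 * (16 * L * ε / (3 * M)) ^ 2 = 2048 / 9 * (L ^ 2 * ε ^ 2 / M ^ 2) by
      field_simp; norm_num]
    gcongr
    norm_num

/-! ### Measurability of the run -/

section Run

variable {d : ℕ} {Ω : Type*} [mΩ : MeasurableSpace Ω] {ℱ : Filtration ℕ mΩ}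
  {O : Oracle d Ω} {σ : ℕ → Ω → ℝ} {μ : Measure Ω}

theorem Oracle.Nonanticipating.lam (hO : O.Nonanticipating ℱ) (k : ℕ) :
    StronglyMeasurable[ℱ k] (O.lam k) := by
  have hc : Continuous fun z : (E d →L[ℝ] E d) × E d => (inner ℝ z.2 (z.1 z.2) : ℝ) := by
    fun_prop
  exact hc.comp_stronglyMeasurable ((hO.H k).prodMk (hO.p k))

theorem Oracle.Nonanticipating.iterate (hO : O.Nonanticipating ℱ) (hσ : RandomSigns μ ℱ σ)
    {a : ℕ → Ω → ℝ} (ha : ∀ k, StronglyMeasurable[ℱ k] (a k)) (L M εg εH : ℝ) (x₀ : E d) (k : ℕ) :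
    StronglyMeasurable[ℱ k] (iterate L M εg εH x₀ O a σ k) := by
  induction k with
  | zero => exact stronglyMeasurable_const
  | succ k ih =>
    have hle : ℱ k ≤ ℱ (k + 1) := ℱ.mono (Nat.le_succ k)
    have hx := ih.mono hle
    have hg := (hO.g k).mono hle
    have hl := (hO.lam k).mono hle
    refine StronglyMeasurable.ite
      (measurableSet_lt measurable_const hg.norm.measurable)
      (hx.sub (hg.fun_const_smul (1 / L)))
      (StronglyMeasurable.ite (measurableSet_lt hl.measurable measurable_const) ?_ hx)
    refine hx.add (StronglyMeasurable.smul (StronglyMeasurable.mul ?_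
      (hσ.measurable k).stronglyMeasurable) ((hO.p k).mono hle))
    simpa only [div_eq_mul_inv] using (((ha k).mono hle).const_mul 2).mul_const _

theorem measurable_gradient (f : E d → ℝ) : Measurable (gradient f) :=
  (InnerProductSpace.toDual ℝ (E d)).symm.continuous.measurable.comp (measurable_fderiv ℝ f)

open Classical in
/-- The coefficient of the sign `σ k` in the first-order change of `f` at a negative curvature
step from `x k` with stepsize `|lam k|`, truncated at `c`. -/
noncomputable def noise (f : E d → ℝ) (M εg εH c : ℝ) (O : Oracle d Ω) (x : ℕ → Ω → E d) (k : ℕ)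
    (ω : Ω) : ℝ :=
  if NegCurvStep εg εH O k ω then
    max (-c) (min c (2 * |O.lam k ω| / M * inner ℝ (gradient f (x k ω)) (O.p k ω)))
  else 0

omit mΩ in
-- The truncation makes the bound hold for all `k` and `ω`, including iterations that are not
-- reached, where nothing is assumed about the oracle. Along the run it is inactive, as shown in
-- `BasicAssumption.iterate_succ_le`.
theorem abs_noise_le (f : E d → ℝ) (M εg εH : ℝ) {c : ℝ} (hc : 0 ≤ c) (O : Oracle d Ω)
    (x : ℕ → Ω → E d) (k : ℕ) (ω : Ω) : |noise f M εg εH c O x k ω| ≤ c := by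
  rw [noise]
  split_ifs
  · exact abs_le.2 ⟨le_max_left _ _, max_le (by linarith) (min_le_left _ _)⟩
  · simpa using hc

theorem Oracle.Nonanticipating.noise (hO : O.Nonanticipating ℱ) (f : E d → ℝ) (M εg εH c : ℝ)
    {x : ℕ → Ω → E d} {k : ℕ} (hx : StronglyMeasurable[ℱ k] (x k)) :
    StronglyMeasurable[ℱ k] (noise f M εg εH c O x k) := by
  refine StronglyMeasurable.ite
    ((measurableSet_le (hO.g k).norm.measurable measurable_const).inter
      (measurableSet_lt (hO.lam k).measurable measurable_const)) ?_ stronglyMeasurable_const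
  have hG : StronglyMeasurable[ℱ k] fun ω => gradient f (x k ω) :=
    ((measurable_gradient f).comp hx.measurable).stronglyMeasurable
  have ha : StronglyMeasurable[ℱ k] fun ω => 2 * |O.lam k ω| / M := by
    simpa only [div_eq_mul_inv, Real.norm_eq_abs] using ((hO.lam k).norm.const_mul 2).mul_const M⁻¹
  have hcont : Continuous fun y : ℝ => max (-c) (min c y) := by fun_prop
  exact hcont.comp_stronglyMeasurable (ha.mul (continuous_inner.comp_stronglyMeasurable
    (hG.prodMk (hO.p k))))

/-! ### Decrease along the run -/

variable {f : E d → ℝ} {D : Set (E d)} {L M fbar : ℝ}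

omit mΩ in
theorem BasicAssumption.iterate_succ_le (h : BasicAssumption f D L M fbar) (hL : 0 < L)
    (hM : 0 < M) {εg εH : ℝ} (hεg : 0 < εg) (hεH : 0 ≤ εH) {x₀ : E d} {x : ℕ → Ω → E d}
    (hx : x = iterate L M εg εH x₀ O (fun k ω => |O.lam k ω|) σ) {ω : Ω}
    (hσ : ∀ k, σ k ω = 1 ∨ σ k ω = -1) (hω : InexactnessAssumption f D εg εH O x ω) {k : ℕ}
    (hk : Reached εg εH O (k + 1) ω) :
    f (x (k + 1) ω) ≤ f (x k ω) - decrease L M εg εH +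
      σ k ω * noise f M εg εH (16 * L * εg / (3 * M)) O x k ω := by
  have hk0 : Reached εg εH O k ω := fun j hj => hk j (by omega)
  obtain ⟨hxk, hg, hH⟩ := hω k hk0
  obtain ⟨hxk1, -⟩ := hω (k + 1) hk
  by_cases hcase : εg < ‖O.g k ω‖
  · have he : x (k + 1) ω = x k ω - (1 / L) • O.g k ω := by
      rw [hx, iterate, if_pos hcase]
    rw [he] at hxk1 ⊢
    have h1 := h.gradient_step hL hεg.le hxk hxk1 hcase hg
    have h2 : decrease L M εg εH ≤ εg ^ 2 / (6 * L) := min_le_left _ _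
    rw [noise, if_neg fun hn => hcase.not_ge hn.1, mul_zero]
    linarith
  · have hlam : O.lam k ω < -εH := by
      by_contra hl
      exact hk k (Nat.lt_succ_self k) ⟨not_lt.1 hcase, not_lt.1 hl⟩
    have he : x (k + 1) ω = x k ω + (2 * |O.lam k ω| / M * σ k ω) • O.p k ω := by
      rw [hx, iterate, if_neg hcase, if_pos hlam]
    obtain ⟨-, hHf, hp, -⟩ := hH (not_lt.1 hcase)
    rw [he] at hxk1 ⊢
    have h1 := h.negCurv_step hM hεH (hσ k) hxk hp hlam hHf hxk1
    have h2 : decrease L M εg εH ≤ 2 * εH ^ 3 / (9 * M ^ 2) := min_le_right _ _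
    have h3 : |O.lam k ω| ≤ 2 * L := h.abs_lam_le hL hxk hp hlam hHf
    have h4 := abs_inner_gradient_le hp (not_lt.1 hcase) hg
    have h5 : |2 * |O.lam k ω| / M * inner ℝ (gradient f (x k ω)) (O.p k ω)| ≤
        16 * L * εg / (3 * M) := by
      rw [abs_mul, abs_of_nonneg (by positivity : 0 ≤ 2 * |O.lam k ω| / M)]
      -- The truncation level comes from here: stepsize at most `2L`, gradient norm at most `4εg/3`.
      calc 2 * |O.lam k ω| / M * |inner ℝ (gradient f (x k ω)) (O.p k ω)|
          ≤ 2 * (2 * L) / M * (4 / 3 * εg) := by gcongr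
        _ = 16 * L * εg / (3 * M) := by field_simp; norm_num
    rw [noise, if_pos ⟨not_lt.1 hcase, hlam⟩, min_eq_right (abs_le.1 h5).2,
      max_eq_right (abs_le.1 h5).1]
    exact h1.trans (by simp only [Oracle.lam]; linarith)

omit mΩ in
theorem BasicAssumption.iterate_le (h : BasicAssumption f D L M fbar) (hL : 0 < L)
    (hM : 0 < M) {εg εH : ℝ} (hεg : 0 < εg) (hεH : 0 ≤ εH) {x₀ : E d} {x : ℕ → Ω → E d}
    (hx : x = iterate L M εg εH x₀ O (fun k ω => |O.lam k ω|) σ) {ω : Ω}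
    (hσ : ∀ k, σ k ω = 1 ∨ σ k ω = -1) (hω : InexactnessAssumption f D εg εH O x ω) {N : ℕ}
    (hN : Reached εg εH O N ω) :
    f (x N ω) ≤ f x₀ - N * decrease L M εg εH +
      ∑ k ∈ Finset.range N, σ k ω * noise f M εg εH (16 * L * εg / (3 * M)) O x k ω := by
  induction N with
  | zero => simp [hx, iterate]
  | succ N ih =>
    have h1 := ih fun j hj => hN j (by omega)
    have h2 := h.iterate_succ_le hL hM hεg hεH hx hσ hω hN
    rw [Finset.sum_range_succ]
    push_cast
    linarith

omit mΩ in
-- Termination asks for a return at a reached index, so strong induction is used to exclude a first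
-- return; `j < ⌈n⌉₊` is the same as `j < n`.
theorem reached_ceil_of_not_terminatesWithin {εg εH n : ℝ} {ω : Ω}
    (h : ¬ TerminatesWithin εg εH O n ω) : Reached εg εH O ⌈n⌉₊ ω := by
  intro j
  induction j using Nat.strong_induction_on with
  | _ j ih =>
    intro hj hr
    exact h ⟨j, Nat.lt_ceil.1 hj, fun i hi => ih i hi (hi.trans hj), hr⟩

/-- Termination within `n` iterations with high probability. -/
theorem BasicAssumption.le_measureReal_terminatesWithin [IsProbabilityMeasure μ]
    (h : BasicAssumption f D L M fbar) (hL : 0 < L) (hM : 0 < M) {ε : ℝ} (hε : 0 < ε) {x₀ : E d}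
    (hσ : RandomSigns μ ℱ σ) (hO : O.Nonanticipating ℱ)
    (hω : ∀ᵐ ω ∂μ, InexactnessAssumption f D ε (Real.sqrt (ε * M)) O
      (iterate L M ε (Real.sqrt (ε * M)) x₀ O (fun k ω => |O.lam k ω|) σ) ω)
    {δ : ℝ} (hδ0 : 0 < δ) (hδ1 : δ < 1) (η : ℕ) :
    1 - δ ≤ μ.real {ω | TerminatesWithin ε (Real.sqrt (ε * M)) O
      (longN L M (f x₀ - fbar) δ η ε) ω} := by
  set εH := Real.sqrt (ε * M) with hεH
  have hεH0 : 0 < εH := Real.sqrt_pos.2 (by positivity)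
  set n := longN L M (f x₀ - fbar) δ η ε with hn
  set x := iterate L M ε εH x₀ O (fun k ω => |O.lam k ω|) σ with hx
  set c := 16 * L * ε / (3 * M) with hc
  have hc0 : 0 < c := by positivity
  set m := decrease L M ε εH with hm
  have hm0 : 0 < m := decrease_pos hL hM hε hεH0
  -- Iteration `0` is always reached, so some outcome witnesses `x₀ ∈ D`.
  have hΔ : 0 ≤ f x₀ - fbar := by
    obtain ⟨ω, h1⟩ := hω.exists
    exact sub_nonneg.2 (h.bounded_below _ (h1 0 fun j hj => absurd hj (Nat.not_lt_zero j)).1)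
  have hlog : 0 < Real.log (1 / δ) := log_one_div_pos hδ0 hδ1
  have hB : 0 < longB L M ε := by rw [longB_eq]; positivity
  have hC : 0 < longC L M ε := by rw [longC_eq hM hε]; positivity
  have hBC : 0 < longB L M ε * (longC L M ε * Real.log (1 / δ)) := by positivity
  have hnle : 2 * ((f x₀ - fbar) / m) + longB L M ε * (longC L M ε * Real.log (1 / δ)) ≤ n := by
    rw [hn, longN, constN]
    exact add_le_add le_rfl
      (mul_le_mul_of_nonneg_left (constC_mul_log_le_constK L M (2 * L) ε εH _ δ η) hB.le)
  have hΔm : 0 ≤ (f x₀ - fbar) / m := by positivity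
  set N := ⌈n⌉₊ with hN
  have hnN : n ≤ N := Nat.le_ceil n
  have hN0 : 0 < N := Nat.ceil_pos.2 (by linarith)
  set Y := noise f M ε εH c O x with hY
  have hYm : ∀ k, StronglyMeasurable[ℱ k] (Y k) := fun k =>
    hO.noise f M ε εH c (hO.iterate hσ (fun k => (hO.lam k).norm) L M ε εH x₀ k)
  have hYc : ∀ k ω, |Y k ω| ≤ c := abs_noise_le f M ε εH hc0.le O x
  have hbad : μ.real {ω | TerminatesWithin ε εH O n ω}ᶜ ≤
      μ.real {ω | N * (m / 2) ≤ ∑ k ∈ Finset.range N, σ k ω * Y k ω} := by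
    refine ENNReal.toReal_mono (measure_ne_top _ _) (measure_mono_ae ?_)
    filter_upwards [hω, hσ.ae_eq] with ω h1 h2 h3
    have hr : Reached ε εH O N ω := reached_ceil_of_not_terminatesWithin h3
    have h4 := h.iterate_le hL hM hε hεH0.le hx h2 h1 hr
    have h5 := h.bounded_below _ (h1 N hr).1
    have h6 : 2 * ((f x₀ - fbar) / m) ≤ N := by linarith
    have h7 : 2 * (f x₀ - fbar) ≤ N * m := by
      rw [← mul_div_assoc, div_le_iff₀ hm0] at h6
      exact h6
    change N * (m / 2) ≤ ∑ k ∈ Finset.range N, σ k ω * Y k ω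
    linarith
  have hexp : Real.exp (-(N * (m / 2) ^ 2 / (2 * c ^ 2))) ≤ δ := by
    rw [← Real.le_log_iff_exp_le hδ0, neg_le, ← Real.log_inv, ← one_div,
      le_div_iff₀ (by positivity)]
    have h1 := sq_le_longB_mul_longC_mul_sq hL hM hε
    have h2 : longB L M ε * (longC L M ε * Real.log (1 / δ)) ≤ N := by linarith
    have h3 := mul_le_mul_of_nonneg_right h2 (sq_nonneg m)
    have h4 := mul_le_mul_of_nonneg_right h1 hlog.le
    rw [← hεH, ← hm, ← hc] at h4
    linarith
  -- Subadditivity suffices, so the termination event need not be shown measurable.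
  have hcompl : (1 : ℝ) ≤ μ.real {ω | TerminatesWithin ε εH O n ω} +
      μ.real {ω | TerminatesWithin ε εH O n ω}ᶜ := by
    have := measureReal_union_le (μ := μ) {ω | TerminatesWithin ε εH O n ω}
      {ω | TerminatesWithin ε εH O n ω}ᶜ
    rwa [Set.union_compl_self, probReal_univ] at this
  have := hσ.measureReal_sum_ge_le hYm hc0 hYc (t := m / 2) (by positivity) hN0
  linarith

omit mΩ in
/-- The bound `2L` on the stepsizes `|lam k|`. -/
theorem BasicAssumption.abs_lam_mem_Icc (h : BasicAssumption f D L M fbar) (hL : 0 < L)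
    {εg εH : ℝ} (hεH : 0 ≤ εH) {x : ℕ → Ω → E d} {ω : Ω}
    (hω : InexactnessAssumption f D εg εH O x ω) {k : ℕ} (hk : Reached εg εH O k ω)
    (hs : NegCurvStep εg εH O k ω) :
    |O.lam k ω| ∈ Set.Icc εH (min (2 * L) |O.lam k ω|) := by
  obtain ⟨hxk, -, hH⟩ := hω k hk
  obtain ⟨-, hHf, hp, -⟩ := hH hs.1
  have h2 := hs.2
  exact ⟨by rw [abs_of_neg (by linarith)]; linarith,
    le_min (h.abs_lam_le hL hxk hp h2 hHf) le_rfl⟩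

end Run

/-! ### Size of the constants as `ε ↓ 0` -/

section Size

variable {L M Δ δ ε : ℝ} {η : ℕ}

theorem div_rpow_le_div_rpow {a u v : ℝ} (ha : 0 ≤ a) (h0 : 0 < ε) (h1 : ε ≤ 1) (huv : u ≤ v) :
    a / ε ^ u ≤ a / ε ^ v :=
  div_le_div_of_nonneg_left ha (Real.rpow_pos_of_pos h0 _)
    (Real.rpow_le_rpow_of_exponent_ge h0 h1 huv)

theorem sqrt_mul_pow_three (hM : 0 < M) (hε : 0 < ε) :
    2 * Real.sqrt (ε * M) ^ 3 / (9 * M ^ 2) =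
      2 * Real.sqrt M / (9 * M) * (ε * Real.sqrt ε) := by
  have : Real.sqrt (ε * M) ^ 3 = ε * M * (Real.sqrt ε * Real.sqrt M) := by
    rw [pow_succ, Real.sq_sqrt (by positivity), Real.sqrt_mul hε.le]
  rw [this]
  field_simp

/-- The curvature term is a multiple of `ε^(3/2)`, which is at least `ε²` for `ε ≤ 1`. -/
theorem le_decrease (hM : 0 < M) (h0 : 0 < ε) (h1 : ε ≤ 1) :
    min (1 / (6 * L)) (2 * Real.sqrt M / (9 * M)) * ε ^ 2 ≤
      decrease L M ε (Real.sqrt (ε * M)) := by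
  have hs : ε ≤ Real.sqrt ε := Real.le_sqrt_of_sq_le (by nlinarith)
  refine le_min ?_ ?_
  · calc min (1 / (6 * L)) (2 * Real.sqrt M / (9 * M)) * ε ^ 2 ≤ 1 / (6 * L) * ε ^ 2 := by
          gcongr; exact min_le_left _ _
      _ = ε ^ 2 / (6 * L) := by ring
  · rw [sqrt_mul_pow_three hM h0]
    calc min (1 / (6 * L)) (2 * Real.sqrt M / (9 * M)) * ε ^ 2
        ≤ 2 * Real.sqrt M / (9 * M) * ε ^ 2 := by gcongr; exact min_le_right _ _
      _ ≤ 2 * Real.sqrt M / (9 * M) * (ε * Real.sqrt ε) := by rw [sq]; gcongr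

/-- For small `ε` the gradient term, of order `ε²`, lies below the curvature term, of order
`ε^(3/2)`. -/
theorem eventually_decrease_eq (hM : 0 < M) :
    ∀ᶠ ε in 𝓝[>] (0 : ℝ), decrease L M ε (Real.sqrt (ε * M)) = ε ^ 2 / (6 * L) := by
  have ht : Tendsto (fun ε : ℝ => 2 * Real.sqrt M / (9 * M) - 1 / (6 * L) * Real.sqrt ε)
      (𝓝[>] 0) (𝓝 (2 * Real.sqrt M / (9 * M))) := by
    have : Continuous fun ε : ℝ => 2 * Real.sqrt M / (9 * M) - 1 / (6 * L) * Real.sqrt ε := by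
      fun_prop
    simpa using (this.tendsto 0).mono_left nhdsWithin_le_nhds
  filter_upwards [ht.eventually_const_lt (by positivity : (0 : ℝ) < 2 * Real.sqrt M / (9 * M)),
    self_mem_nhdsWithin] with ε hε h0
  have h0 : 0 < ε := h0
  refine min_eq_left ?_
  rw [sqrt_mul_pow_three hM h0]
  calc ε ^ 2 / (6 * L) = 1 / (6 * L) * Real.sqrt ε * (ε * Real.sqrt ε) := by
        rw [show 1 / (6 * L) * Real.sqrt ε * (ε * Real.sqrt ε) =
          1 / (6 * L) * (Real.sqrt ε ^ 2 * ε) by ring, Real.sq_sqrt h0.le]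
        ring
    _ ≤ 2 * Real.sqrt M / (9 * M) * (ε * Real.sqrt ε) := by gcongr; linarith

theorem longB_le (h0 : 0 < ε) (h1 : ε ≤ 1) :
    longB L M ε ≤ (1 + 36 * L ^ 2 / M) / ε := by
  rw [longB_eq, add_div]
  gcongr
  rwa [le_div_iff₀ h0, one_mul]

theorem longK_nonneg (hL : 0 < L) (hM : 0 < M) (h0 : 0 < ε) (hδ0 : 0 < δ) (hδ1 : δ < 1) :
    0 ≤ longK L M Δ δ η ε := by
  refine le_trans ?_ (constC_mul_log_le_constK L M (2 * L) ε (Real.sqrt (ε * M)) Δ δ η)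
  have h : constC M (2 * L) ε (Real.sqrt (ε * M)) = _ := longC_eq hM h0
  have := log_one_div_pos hδ0 hδ1
  rw [h]
  positivity

theorem longN_eq : longN L M Δ δ η ε =
    2 * (Δ / decrease L M ε (Real.sqrt (ε * M))) + longB L M ε * longK L M Δ δ η ε :=
  rfl

theorem longN_nonneg (hL : 0 < L) (hM : 0 < M) (hΔ : 0 ≤ Δ) (h0 : 0 < ε) (hδ0 : 0 < δ)
    (hδ1 : δ < 1) : 0 ≤ longN L M Δ δ η ε := by
  have h1 := decrease_pos hL hM h0 (Real.sqrt_pos.2 (mul_pos h0 hM))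
  have h2 : 0 ≤ longB L M ε := by rw [longB_eq]; positivity
  have h3 := longK_nonneg (Δ := Δ) (η := η) hL hM h0 hδ0 hδ1
  rw [longN_eq]
  positivity

theorem one_le_cast_sub_one (hη : 2 ≤ η) : (1 : ℝ) ≤ (η : ℝ) - 1 := by
  have : (2 : ℝ) ≤ η := by exact_mod_cast hη
  linarith

theorem longK_eq (hM : 0 < M) (h0 : 0 < ε) : longK L M Δ δ η ε =
    max (9216 * L ^ 2 / M / ε * Real.log (1 / δ))
      (max (4 * η * (9216 * L ^ 2 / M / ε) *
          (Δ / decrease L M ε (Real.sqrt (ε * M))) ^ (1 / (η : ℝ)))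
        (4 * (η : ℝ) ^ 2 * (9216 * L ^ 2 / M / ε) ^ (1 + 1 / ((η : ℝ) - 1)) *
          longB L M ε ^ (1 / ((η : ℝ) - 1)))) := by
  have h : constC M (2 * L) ε (Real.sqrt (ε * M)) = _ := longC_eq hM h0
  rw [longK, constK, h]
  rfl

theorem exists_longK_le (hL : 0 < L) (hM : 0 < M) (hΔ : 0 ≤ Δ) (hη : 2 ≤ η) :
    ∃ c : ℝ, 0 < c ∧ ∀ ε : ℝ, 0 < ε → ε ≤ 1 → ∀ δ : ℝ, 0 < δ → δ < 1 →
      longK L M Δ δ η ε ≤ c * (1 + Real.log (1 / δ)) / ε ^ (1 + 2 / ((η : ℝ) - 1)) := by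
  have hη1 := one_le_cast_sub_one hη
  have hη0 : (0 : ℝ) < η := by linarith
  set γ := 9216 * L ^ 2 / M with hγ
  set β := 36 * L ^ 2 / M with hβ
  set m := min (1 / (6 * L)) (2 * Real.sqrt M / (9 * M)) with hm
  set r := 1 / ((η : ℝ) - 1) with hr
  have hγ0 : 0 < γ := by positivity
  have hβ0 : 0 < β := by positivity
  have hm0 : 0 < m := lt_min (by positivity) (by positivity)
  have hr0 : 0 < r := by positivity
  have hq : 2 / ((η : ℝ) - 1) = 2 * r := by rw [hr]; ring
  rw [hq]
  have hA2 : 0 ≤ 4 * η * γ * (Δ / m) ^ (1 / (η : ℝ)) := by positivity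
  have hA3 : 0 ≤ 4 * (η : ℝ) ^ 2 * γ ^ (1 + r) * (1 + β) ^ r := by positivity
  -- One summand for each entry of the maximum, all compared with the largest power `ε^(-1-2r)`.
  refine ⟨γ + 4 * η * γ * (Δ / m) ^ (1 / (η : ℝ)) +
    4 * (η : ℝ) ^ 2 * γ ^ (1 + r) * (1 + β) ^ r, by positivity, ?_⟩
  intro ε h0 h1 δ hδ0 hδ1
  have hlog := log_one_div_pos hδ0 hδ1
  have hdec := le_decrease (L := L) hM h0 h1
  rw [← hm] at hdec
  have hmono : ∀ {a u : ℝ}, 0 ≤ a → a ≤ γ + 4 * η * γ * (Δ / m) ^ (1 / (η : ℝ)) +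
      4 * (η : ℝ) ^ 2 * γ ^ (1 + r) * (1 + β) ^ r → u ≤ 1 + 2 * r →
      a / ε ^ u ≤ (γ + 4 * η * γ * (Δ / m) ^ (1 / (η : ℝ)) +
      4 * (η : ℝ) ^ 2 * γ ^ (1 + r) * (1 + β) ^ r) * (1 + Real.log (1 / δ)) /
        ε ^ (1 + 2 * r) := fun {a u} ha hac hu => by
    refine (div_rpow_le_div_rpow ha h0 h1 hu).trans ?_
    gcongr
    nlinarith
  rw [longK_eq hM h0, ← hγ, ← hr]
  refine max_le ?_ (max_le ?_ ?_)
  · calc γ / ε * Real.log (1 / δ) = γ * Real.log (1 / δ) / ε ^ (1 : ℝ) := by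
          rw [Real.rpow_one]; ring
      _ ≤ γ * Real.log (1 / δ) / ε ^ (1 + 2 * r) :=
          div_rpow_le_div_rpow (by positivity) h0 h1 (by linarith)
      _ ≤ _ := by gcongr <;> linarith
  · calc 4 * η * (γ / ε) * (Δ / decrease L M ε (Real.sqrt (ε * M))) ^ (1 / (η : ℝ))
        ≤ 4 * η * (γ / ε) * (Δ / (m * ε ^ 2)) ^ (1 / (η : ℝ)) := by
          have := decrease_pos hL hM h0 (Real.sqrt_pos.2 (mul_pos h0 hM))
          gcongr
      _ = 4 * η * γ * (Δ / m) ^ (1 / (η : ℝ)) / ε ^ (1 + 2 / (η : ℝ)) := by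
          have h2 : (ε ^ 2) ^ (1 / (η : ℝ)) = ε ^ (2 / (η : ℝ)) := by
            rw [← Real.rpow_natCast, ← Real.rpow_mul h0.le]
            congr 1
            push_cast
            ring
          rw [← div_div, Real.div_rpow (by positivity) (by positivity), h2, Real.rpow_add h0,
            Real.rpow_one]
          field_simp
      _ ≤ _ := by
          refine hmono hA2 (by linarith) ?_
          have : 2 / (η : ℝ) ≤ 2 / ((η : ℝ) - 1) :=
            div_le_div_of_nonneg_left (by norm_num) (by linarith) (by linarith)
          linarith
  · calc 4 * (η : ℝ) ^ 2 * (γ / ε) ^ (1 + r) * longB L M ε ^ r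
        ≤ 4 * (η : ℝ) ^ 2 * (γ / ε) ^ (1 + r) * ((1 + β) / ε) ^ r := by
          have : 0 ≤ longB L M ε := by rw [longB_eq]; positivity
          gcongr
          exact longB_le h0 h1
      _ = 4 * (η : ℝ) ^ 2 * γ ^ (1 + r) * (1 + β) ^ r / ε ^ (1 + 2 * r) := by
          rw [Real.div_rpow hγ0.le h0.le, Real.div_rpow (by positivity) h0.le,
            show 1 + 2 * r = (1 + r) + r by ring, Real.rpow_add h0 (1 + r) r]
          field_simp
      _ ≤ _ := hmono hA3 (by linarith) le_rfl

theorem exists_longK_le_and_longN_le (hL : 0 < L) (hM : 0 < M) (hΔ : 0 ≤ Δ) (hη : 2 ≤ η) :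
    ∃ c : ℝ, 0 < c ∧ ∀ ε : ℝ, 0 < ε → ε ≤ 1 → ∀ δ : ℝ, 0 < δ → δ < 1 →
      longK L M Δ δ η ε ≤ c * (1 + Real.log (1 / δ)) / ε ^ (1 + 2 / ((η : ℝ) - 1)) ∧
      longN L M Δ δ η ε ≤ c * (1 + Real.log (1 / δ)) / ε ^ (2 + 2 / ((η : ℝ) - 1)) := by
  obtain ⟨c, hc0, hc⟩ := exists_longK_le hL hM hΔ hη
  have hη1 := one_le_cast_sub_one hη
  set β := 36 * L ^ 2 / M with hβ
  set m := min (1 / (6 * L)) (2 * Real.sqrt M / (9 * M)) with hm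
  set q := 2 / ((η : ℝ) - 1) with hq
  have hβ0 : 0 < β := by positivity
  have hm0 : 0 < m := lt_min (by positivity) (by positivity)
  have hq0 : 0 < q := by positivity
  refine ⟨c + (2 * (Δ / m) + (1 + β) * c), by positivity, ?_⟩
  intro ε h0 h1 δ hδ0 hδ1
  have hlog := log_one_div_pos hδ0 hδ1
  have hK := hc ε h0 h1 δ hδ0 hδ1
  refine ⟨hK.trans ?_, ?_⟩
  · have : 0 ≤ 2 * (Δ / m) + (1 + β) * c := by positivity
    gcongr
    linarith
  · have hdec := le_decrease (L := L) hM h0 h1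
    rw [← hm] at hdec
    have h2 : 2 * (Δ / decrease L M ε (Real.sqrt (ε * M))) ≤
        2 * (Δ / m) * (1 + Real.log (1 / δ)) / ε ^ (2 + q) := by
      calc 2 * (Δ / decrease L M ε (Real.sqrt (ε * M))) ≤ 2 * (Δ / (m * ε ^ 2)) := by gcongr
        _ = 2 * (Δ / m) / ε ^ (2 : ℝ) := by rw [Real.rpow_two]; field_simp
        _ ≤ 2 * (Δ / m) / ε ^ (2 + q) :=
            div_rpow_le_div_rpow (by positivity) h0 h1 (by linarith)
        _ ≤ _ := by
            refine div_le_div_of_nonneg_right ?_ (by positivity)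
            exact le_mul_of_one_le_right (by positivity) (by linarith)
    have h3 : longB L M ε * longK L M Δ δ η ε ≤
        (1 + β) * c * (1 + Real.log (1 / δ)) / ε ^ (2 + q) := by
      have hB : 0 ≤ (1 + β) / ε := by positivity
      calc longB L M ε * longK L M Δ δ η ε
          ≤ (1 + β) / ε * (c * (1 + Real.log (1 / δ)) / ε ^ (1 + q)) :=
            mul_le_mul (longB_le h0 h1) hK (longK_nonneg hL hM h0 hδ0 hδ1) hB
        _ = (1 + β) * c * (1 + Real.log (1 / δ)) / ε ^ (2 + q) := by
            rw [show 2 + q = 1 + (1 + q) by ring, Real.rpow_add h0 1 (1 + q), Real.rpow_one]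
            field_simp
    have h4 : (0 : ℝ) ≤ c * (1 + Real.log (1 / δ)) / ε ^ (2 + q) := by positivity
    rw [longN_eq, add_mul, add_div, add_mul, add_div]
    linarith

theorem isBigOTilde_of_le {F : ℝ → ℝ} {c u v : ℝ} (huv : u ≤ v) (hF : ∀ ε, 0 < ε → 0 ≤ F ε)
    (h : ∀ ε, 0 < ε → ε ≤ 1 → F ε ≤ c / ε ^ u) :
    IsBigOTilde (𝓝[>] 0) F fun ε => 1 / ε ^ v := by
  -- No logarithm is needed: for fixed `δ` the bound is a pure power.
  refine ⟨0, IsBigO.of_bound |c| ?_⟩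
  filter_upwards [Ioc_mem_nhdsGT (zero_lt_one' ℝ)] with ε hε
  have hp := Real.rpow_pos_of_pos hε.1 v
  have hp' := Real.rpow_pos_of_pos hε.1 u
  rw [pow_zero, mul_one, Real.norm_of_nonneg (hF ε hε.1), Real.norm_of_nonneg (by positivity),
    mul_one_div]
  calc F ε ≤ c / ε ^ u := h ε hε.1 hε.2
    _ ≤ |c| / ε ^ u := by gcongr; exact le_abs_self c
    _ ≤ |c| / ε ^ v := div_rpow_le_div_rpow (abs_nonneg c) hε.1 hε.2 huv

theorem isBigO_div_longC (hM : 0 < M) :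
    longC L M =O[𝓝[>] 0] fun ε : ℝ => 1 / ε := by
  refine (isBigO_const_mul_self (9216 * L ^ 2 / M) (fun ε : ℝ => 1 / ε) (𝓝[>] 0)).congr' ?_
    EventuallyEq.rfl
  filter_upwards [self_mem_nhdsWithin] with ε hε
  rw [longC_eq hM hε, mul_one_div]

theorem isBigO_div_longB (hL : 0 < L) (hM : 0 < M) :
    longB L M =O[𝓝[>] 0] fun ε : ℝ => 1 / ε := by
  refine IsBigO.of_bound (1 + 36 * L ^ 2 / M) ?_
  filter_upwards [Ioc_mem_nhdsGT (zero_lt_one' ℝ)] with ε hε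
  have h0 := hε.1
  have hB : 0 ≤ longB L M ε := by rw [longB_eq]; positivity
  rw [Real.norm_of_nonneg hB, Real.norm_of_nonneg (by positivity), mul_one_div]
  exact longB_le h0 hε.2

/-! ### Limits -/

theorem tendsto_const_mul_rpow_nhdsGT_zero (a : ℝ) {q : ℝ} (hq : 0 < q) :
    Tendsto (fun ε : ℝ => a * ε ^ q) (𝓝[>] 0) (𝓝 0) := by
  have h := (Real.continuousAt_rpow_const 0 q (Or.inr hq.le)).tendsto.mono_left
    (nhdsWithin_le_nhds (s := Set.Ioi 0))
  simpa [Real.zero_rpow hq.ne'] using h.const_mul a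

/-- After rescaling, the first two entries keep a positive power of `ε` (as `2/η < 2/(η-1)`) and
vanish, so the limit depends on neither `Δ` nor `δ`. -/
theorem tendsto_longK_mul_rpow (hL : 0 < L) (hM : 0 < M) (hΔ : 0 ≤ Δ) (hη : 2 ≤ η) (δ : ℝ) :
    Tendsto (fun ε : ℝ => longK L M Δ δ η ε * ε ^ (1 + 2 / ((η : ℝ) - 1))) (𝓝[>] 0)
      (𝓝 (4 * (η : ℝ) ^ 2 * (9216 * L ^ 2 / M) ^ (1 + 1 / ((η : ℝ) - 1)) *
        (36 * L ^ 2 / M) ^ (1 / ((η : ℝ) - 1)))) := by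
  have hη1 := one_le_cast_sub_one hη
  have hη0 : (0 : ℝ) < η := by linarith
  set γ := 9216 * L ^ 2 / M with hγ
  set β := 36 * L ^ 2 / M with hβ
  set r := 1 / ((η : ℝ) - 1) with hr
  have hγ0 : 0 < γ := by positivity
  have hβ0 : 0 < β := by positivity
  have hr0 : 0 < r := by positivity
  have hq : 2 / ((η : ℝ) - 1) = 2 * r := by rw [hr]; ring
  rw [hq]
  have hηr : 2 / (η : ℝ) < 2 * r := by
    rw [← hq]
    exact div_lt_div_of_pos_left (by norm_num) (by linarith) (by linarith)
  have t1 : Tendsto (fun ε : ℝ => γ * Real.log (1 / δ) * ε ^ (2 * r)) (𝓝[>] 0) (𝓝 0) :=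
    tendsto_const_mul_rpow_nhdsGT_zero _ (by positivity)
  have t2 : Tendsto (fun ε : ℝ => 4 * η * γ * (Δ * (6 * L)) ^ (1 / (η : ℝ)) *
      ε ^ (2 * r - 2 / (η : ℝ))) (𝓝[>] 0) (𝓝 0) :=
    tendsto_const_mul_rpow_nhdsGT_zero _ (by linarith)
  have t3 : Tendsto (fun ε : ℝ => 4 * (η : ℝ) ^ 2 * γ ^ (1 + r) * (ε + β) ^ r) (𝓝[>] 0)
      (𝓝 (4 * (η : ℝ) ^ 2 * γ ^ (1 + r) * β ^ r)) := by
    have h1 : Tendsto (fun ε : ℝ => ε + β) (𝓝[>] 0) (𝓝 β) := by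
      have : Continuous fun ε : ℝ => ε + β := by fun_prop
      simpa using (this.tendsto 0).mono_left nhdsWithin_le_nhds
    exact (h1.rpow_const (Or.inl hβ0.ne')).const_mul _
  have t := t1.max (t2.max t3)
  have hpos : 0 ≤ 4 * (η : ℝ) ^ 2 * γ ^ (1 + r) * β ^ r := by positivity
  rw [max_eq_right hpos, max_eq_right hpos] at t
  refine t.congr' ?_
  filter_upwards [eventually_decrease_eq hM, self_mem_nhdsWithin] with ε hdec h0
  have h0 : 0 < ε := h0
  have hp : 0 < ε ^ (1 + 2 * r) := Real.rpow_pos_of_pos h0 _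
  rw [longK_eq hM h0, ← hγ, ← hr, max_mul_of_nonneg _ _ hp.le, max_mul_of_nonneg _ _ hp.le, hdec]
  congr 1
  · rw [Real.rpow_add h0, Real.rpow_one]
    field_simp
  congr 1
  · have h2 : (ε ^ 2) ^ (1 / (η : ℝ)) = ε ^ (2 / (η : ℝ)) := by
      rw [← Real.rpow_natCast, ← Real.rpow_mul h0.le]
      congr 1
      push_cast
      ring
    rw [show Δ / (ε ^ 2 / (6 * L)) = Δ * (6 * L) / ε ^ 2 by field_simp,
      Real.div_rpow (by positivity) (by positivity), h2, Real.rpow_sub h0, Real.rpow_add h0,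
      Real.rpow_one]
    field_simp
  · rw [longB_eq, ← hβ, show 1 + β / ε = (ε + β) / ε by field_simp,
      Real.div_rpow hγ0.le h0.le, Real.div_rpow (by positivity) h0.le,
      show 1 + 2 * r = (1 + r) + r by ring, Real.rpow_add h0 (1 + r) r]
    field_simp

/-- The limit of `n ε ^ (2 + 2 / (η - 1))` as `ε ↓ 0`. -/
noncomputable def limitConst (L M : ℝ) (η : ℕ) : ℝ :=
  36 * L ^ 2 / M * (4 * (η : ℝ) ^ 2 * (9216 * L ^ 2 / M) ^ (1 + 1 / ((η : ℝ) - 1)) *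
    (36 * L ^ 2 / M) ^ (1 / ((η : ℝ) - 1)))

theorem tendsto_longN_mul_rpow (hL : 0 < L) (hM : 0 < M) (hΔ : 0 ≤ Δ) (hη : 2 ≤ η) (δ : ℝ) :
    Tendsto (fun ε : ℝ => longN L M Δ δ η ε * ε ^ (2 + 2 / ((η : ℝ) - 1))) (𝓝[>] 0)
      (𝓝 (limitConst L M η)) := by
  have hη1 := one_le_cast_sub_one hη
  set q := 2 / ((η : ℝ) - 1) with hq
  have hq0 : 0 < q := by positivity
  have t1 : Tendsto (fun ε : ℝ => 2 * (Δ * (6 * L)) * ε ^ q) (𝓝[>] 0) (𝓝 0) :=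
    tendsto_const_mul_rpow_nhdsGT_zero _ hq0
  have t2 : Tendsto (fun ε : ℝ => ε + 36 * L ^ 2 / M) (𝓝[>] 0) (𝓝 (36 * L ^ 2 / M)) := by
    have : Continuous fun ε : ℝ => ε + 36 * L ^ 2 / M := by fun_prop
    simpa using (this.tendsto 0).mono_left nhdsWithin_le_nhds
  have t := t1.add (t2.mul (tendsto_longK_mul_rpow hL hM hΔ hη δ))
  rw [zero_add] at t
  refine t.congr' ?_
  filter_upwards [eventually_decrease_eq hM, self_mem_nhdsWithin] with ε hdec h0
  have h0 : 0 < ε := h0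
  rw [longN_eq, hdec, longB_eq, ← hq, show 2 + q = 1 + (1 + q) by ring, Real.rpow_add h0 1 (1 + q),
    Real.rpow_add h0 1 q, Real.rpow_one]
  field_simp

/-- The exponents `1/(η-1)` tend to zero, so the powers converge to a positive limit and the factor
`η²` drives the divergence. -/
theorem tendsto_limitConst (hL : 0 < L) (hM : 0 < M) : Tendsto (limitConst L M) atTop atTop := by
  have hγ0 : 0 < 9216 * L ^ 2 / M := by positivity
  have hβ0 : 0 < 36 * L ^ 2 / M := by positivity
  have hr : Tendsto (fun η : ℕ => 1 / ((η : ℝ) - 1)) atTop (𝓝 0) := by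
    simp only [one_div]
    exact tendsto_inv_atTop_zero.comp
      (tendsto_atTop_add_const_right _ (-1) tendsto_natCast_atTop_atTop)
  have h1 : Tendsto (fun η : ℕ => (9216 * L ^ 2 / M) ^ (1 + 1 / ((η : ℝ) - 1)) *
      (36 * L ^ 2 / M) ^ (1 / ((η : ℝ) - 1))) atTop (𝓝 (9216 * L ^ 2 / M)) := by
    have := ((tendsto_const_nhds (x := 9216 * L ^ 2 / M)).rpow (hr.const_add 1)
      (Or.inl hγ0.ne')).mul ((tendsto_const_nhds (x := 36 * L ^ 2 / M)).rpow hr (Or.inl hβ0.ne'))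
    simpa using this
  have h2 : Tendsto (fun η : ℕ => 36 * L ^ 2 / M * 4 * (η : ℝ) ^ 2) atTop atTop :=
    ((tendsto_pow_atTop two_ne_zero).comp tendsto_natCast_atTop_atTop).const_mul_atTop
      (by positivity)
  refine (h2.atTop_mul_pos hγ0 h1).congr fun η => ?_
  rw [limitConst]
  ring

end Size

end InexactNC

theorem mainTheorem4 (L M : ℝ) (hL : 0 < L) (hM : 0 < M) :
    -- the run with stepsizes `|lam k|`: the bound `α = 2L` is admissible, and the algorithm
    -- terminates within `n` iterations with probability at least `1 - δ`
    (∀ (d : ℕ) (f : InexactNC.E d → ℝ) (D : Set (InexactNC.E d)) (fbar : ℝ),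
      InexactNC.BasicAssumption f D L M fbar →
      ∀ (x₀ : InexactNC.E d) (ε : ℝ), 0 < ε →
      ∀ (Ω : Type*) (mΩ : MeasurableSpace Ω) (μ : Measure Ω), IsProbabilityMeasure μ →
      ∀ (ℱ : Filtration ℕ mΩ) (σ : ℕ → Ω → ℝ) (O : InexactNC.Oracle d Ω),
        InexactNC.RandomSigns μ ℱ σ → O.Nonanticipating ℱ →
        (∀ᵐ ω ∂μ, InexactNC.InexactnessAssumption f D ε (Real.sqrt (ε * M)) O
          (InexactNC.iterate L M ε (Real.sqrt (ε * M)) x₀ O (fun k ω => |O.lam k ω|) σ) ω) →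
        (∀ᵐ ω ∂μ, ∀ k, InexactNC.Reached ε (Real.sqrt (ε * M)) O k ω →
          InexactNC.NegCurvStep ε (Real.sqrt (ε * M)) O k ω →
          |O.lam k ω| ∈ Set.Icc (Real.sqrt (ε * M)) (min (2 * L) |O.lam k ω|)) ∧
        ∀ (δ : ℝ), 0 < δ → δ < 1 → ∀ (η : ℕ), 2 ≤ η →
          1 - δ ≤ μ.real {ω | InexactNC.TerminatesWithin ε (Real.sqrt (ε * M)) O
            (InexactNC.longN L M (f x₀ - fbar) δ η ε) ω}) ∧
    -- `B = O(1/ε)` and `C = O(1/ε)`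
    (InexactNC.longB L M =O[𝓝[>] 0] fun ε : ℝ => 1 / ε) ∧
    (InexactNC.longC L M =O[𝓝[>] 0] fun ε : ℝ => 1 / ε) ∧
    -- the size of `K` and `n`, where `Δ` stands for `f x₀ - fbar`
    ∀ (Δ : ℝ), 0 ≤ Δ →
      -- `η = 11`
      (∀ (δ : ℝ), 0 < δ → δ < 1 →
        InexactNC.IsBigOTilde (𝓝[>] 0) (InexactNC.longK L M Δ δ 11)
          (fun ε => 1 / ε ^ (1.2 : ℝ)) ∧
        InexactNC.IsBigOTilde (𝓝[>] 0) (InexactNC.longN L M Δ δ 11)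
          (fun ε => 1 / ε ^ (2.2 : ℝ))) ∧
      -- every `η`, with the dependence on `δ` explicit (for `η = 11`: exponents 1.2 and 2.2)
      (∀ (η : ℕ), 2 ≤ η → ∃ c : ℝ, 0 < c ∧
        ∀ (ε : ℝ), 0 < ε → ε ≤ 1 → ∀ (δ : ℝ), 0 < δ → δ < 1 →
          InexactNC.longK L M Δ δ η ε ≤
            c * (1 + Real.log (1 / δ)) / ε ^ (1 + 2 / ((η : ℝ) - 1)) ∧
          InexactNC.longN L M Δ δ η ε ≤
            c * (1 + Real.log (1 / δ)) / ε ^ (2 + 2 / ((η : ℝ) - 1))) ∧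
      -- a large `η` brings the exponent as close to 2 as desired
      (∀ (κ : ℝ), 0 < κ → ∃ η₀ : ℕ, ∀ (η : ℕ), η₀ ≤ η → ∀ (δ : ℝ), 0 < δ → δ < 1 →
        InexactNC.IsBigOTilde (𝓝[>] 0) (InexactNC.longN L M Δ δ η)
          (fun ε => 1 / ε ^ (2 + κ))) ∧
      -- at the expense of a larger constant factor
      (∃ c : ℕ → ℝ, Tendsto c atTop atTop ∧
        ∀ (η : ℕ), 2 ≤ η → ∀ (δ : ℝ), 0 < δ → δ < 1 →
          Tendsto (fun ε : ℝ => InexactNC.longN L M Δ δ η ε *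
            ε ^ (2 + 2 / ((η : ℝ) - 1))) (𝓝[>] 0) (𝓝 (c η))) := by
  refine ⟨fun d f D fbar h x₀ ε hε Ω mΩ μ _ ℱ σ O hσ hO hω => ⟨?_, fun δ hδ0 hδ1 η _ =>
      h.le_measureReal_terminatesWithin hL hM hε hσ hO hω hδ0 hδ1 η⟩,
    InexactNC.isBigO_div_longB hL hM, InexactNC.isBigO_div_longC hM, fun Δ hΔ =>
    ⟨fun δ hδ0 hδ1 => ?_, fun η hη => InexactNC.exists_longK_le_and_longN_le hL hM hΔ hη,
      fun κ hκ => ?_, InexactNC.limitConst L M, InexactNC.tendsto_limitConst hL hM,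
      fun η hη δ _ _ => InexactNC.tendsto_longN_mul_rpow hL hM hΔ hη δ⟩⟩
  · filter_upwards [hω] with ω h1 k hk hs
    exact h.abs_lam_mem_Icc hL (Real.sqrt_nonneg _) h1 hk hs
  -- For `η = 11` the extra exponent is `2/10 = 0.2`.
  · obtain ⟨c, -, hc⟩ := InexactNC.exists_longK_le_and_longN_le (η := 11) hL hM hΔ (by norm_num)
    exact ⟨InexactNC.isBigOTilde_of_le (by norm_num)
        (fun ε h0 => InexactNC.longK_nonneg hL hM h0 hδ0 hδ1)
        fun ε h0 h1 => (hc ε h0 h1 δ hδ0 hδ1).1,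
      InexactNC.isBigOTilde_of_le (by norm_num)
        (fun ε h0 => InexactNC.longN_nonneg hL hM hΔ h0 hδ0 hδ1)
        fun ε h0 h1 => (hc ε h0 h1 δ hδ0 hδ1).2⟩
  -- With `m > 2/κ` and `η ≥ m + 2`, `η - 1` exceeds `2/κ`, so `2/(η-1) ≤ κ`.
  · obtain ⟨m, hm⟩ := exists_nat_gt (2 / κ)
    refine ⟨m + 2, fun η hη δ hδ0 hδ1 => ?_⟩
    obtain ⟨c, -, hc⟩ := InexactNC.exists_longK_le_and_longN_le (η := η) hL hM hΔ (by omega)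
    have hη' : (m : ℝ) + 2 ≤ η := by exact_mod_cast hη
    have hpos : 0 < 2 / κ := by positivity
    have hexp : 2 / ((η : ℝ) - 1) ≤ κ := by
      rw [div_lt_iff₀ hκ] at hm
      rw [div_le_iff₀ (by linarith)]
      nlinarith
    exact InexactNC.isBigOTilde_of_le (by linarith)
      (fun ε h0 => InexactNC.longN_nonneg hL hM hΔ h0 hδ0 hδ1)
      fun ε h0 h1 => (hc ε h0 h1 δ hδ0 hδ1).2
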